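/- Let $T>0$, let $(\Omega,\mathcal F,P)$ be a complete probability space and let $W:L^2([0,T]\times[0,1])\to L^2(\Omega)$ be a linear map such that every $W(g)$ is a centered Gaussian random variable and $E[W(g)W(k)]=\langle g,k\rangle_{L^2([0,T]\times[0,1])}$ for all $g,k$. Assume that $\mathcal F$ is the completion of $\sigma\{W(g): g\in L^2([0,T]\times[0,1])\}$ with the $P$-null sets. A random variable is called smooth if it has the form $F=f(W(k_1),\dots,W(k_n))$ with $k_1,\dots,k_n\in L^2([0,T]\times[0,1])$ and $f\in C_c^\infty(\mathbb R^n)$; its Malliavin derivative is $DF=\sum_{j=1}^n \partial_j f(W(k_1),\dots,W(k_n))\,k_j$. For $h\in L^2([0,T]\times[0,1])$ put $D^hF=\langle DF,h\rangle$. Let $\mathbb D^{h,2}\subset L^2(\Omega)$ be the closure of the set of smooth random variables with respect to the norm $\|F\|_{h,2}=(E[F^2]+E[(D^hF)^2])^{1/2}$, that is, the set of $F\in L^2(\Omega)$ for which there are smooth $G_m$ such that $G_m\to F$ and $D^hG_m$ converges in $L^2(\Omega)$; the limit of $D^hG_m$ is denoted by $D^hF$. **Lemma.** Let $h\in L^2([0,T]\times[0,1])$,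 let $F\in L^2(\Omega)$ and let $(F_N)_{N\ge 1}\subset\mathbb D^{h,2}$ be a sequence such that $F_N\to F$ in $L^2(\Omega)$ and $\sup_{N\ge1}E[(D^hF_N)^2]<\infty$. Then $F\in\mathbb D^{h,2}$, and $D^hF_N\to D^hF$ in the weak topology of $L^2(\Omega)$. -/

import Mathlib

open MeasureTheory ProbabilityTheory Filter Topology

noncomputable section

/-- Lebesgue measure on the rectangle `[0,T] × [0,1]`. -/
def rectMeasure (T : ℝ) : Measure (ℝ × ℝ) :=
  (volume : Measure (ℝ × ℝ)).restrict (Set.Icc 0 T ×ˢ Set.Icc 0 1)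

/-- The Hilbert space `L²([0,T] × [0,1])`. -/
abbrev L2Rect (T : ℝ) : Type := Lp ℝ 2 (rectMeasure T)

/-- The standing assumptions on the Gaussian noise `W : L²([0,T] × [0,1]) → L²(Ω)`: every `W g` is
a centered Gaussian random variable, the covariance is the inner product of `L²([0,T] × [0,1])`,
and (for a complete measure `P`) the σ-algebra of `Ω` is the completion of `σ{W g}` with the
`P`-null sets. -/
structure IsGaussianNoise {Ω : Type*} [MeasurableSpace Ω] (P : Measure Ω) {T : ℝ}
    (W : L2Rect T →ₗ[ℝ] Lp ℝ 2 P) : Prop where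
  gaussian : ∀ g : L2Rect T, HasGaussianLaw (W g : Ω → ℝ) P
  centered : ∀ g : L2Rect T, ∫ ω, W g ω ∂P = 0
  covariance : ∀ g k : L2Rect T, ∫ ω, W g ω * W k ω ∂P = inner ℝ g k
  generated : ∀ A : Set Ω, MeasurableSet A →
    ∃ B : Set Ω, MeasurableSet[⨆ g : L2Rect T,
      MeasurableSpace.comap (W g : Ω → ℝ) (inferInstance : MeasurableSpace ℝ)] B ∧ A =ᵐ[P] B

section Malliavin

variable {Ω : Type*} [MeasurableSpace Ω] {P : Measure Ω} {T : ℝ}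

/-- The random variable `f (W k₁, …, W kₙ)`. -/
def cylinderVar (W : L2Rect T →ₗ[ℝ] Lp ℝ 2 P) {n : ℕ} (f : (Fin n → ℝ) → ℝ)
    (k : Fin n → L2Rect T) (ω : Ω) : ℝ :=
  f (fun i => W (k i) ω)

/-- The Malliavin derivative `∑ j, ∂ⱼ f (W k₁, …, W kₙ) kⱼ` of `f (W k₁, …, W kₙ)`, a random
element of `L²([0,T] × [0,1])`. -/
def cylinderDeriv (W : L2Rect T →ₗ[ℝ] Lp ℝ 2 P) {n : ℕ} (f : (Fin n → ℝ) → ℝ)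
    (k : Fin n → L2Rect T) (ω : Ω) : L2Rect T :=
  ∑ j : Fin n, (fderiv ℝ f (fun i => W (k i) ω) (Pi.single j 1)) • k j

/-- The pairs `(F, D^h F)` with `F = f (W k₁, …, W kₙ)`, `f ∈ C_c^∞(ℝⁿ)`, a smooth random variable
and `D^h F = ⟨D F, h⟩`, as elements of `L²(Ω) × L²(Ω)`. -/
def smoothGraph (W : L2Rect T →ₗ[ℝ] Lp ℝ 2 P) (h : L2Rect T) :
    Set (Lp ℝ 2 P × Lp ℝ 2 P) :=
  {p | ∃ (n : ℕ) (f : (Fin n → ℝ) → ℝ) (k : Fin n → L2Rect T),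
    ContDiff ℝ ((⊤ : ℕ∞) : WithTop ℕ∞) f ∧ HasCompactSupport f ∧
    (p.1 : Ω → ℝ) =ᵐ[P] cylinderVar W f k ∧
    (p.2 : Ω → ℝ) =ᵐ[P] fun ω => inner ℝ (cylinderDeriv W f k ω) h}

/-- The space `𝔻^{h,2}`, the closure of the smooth random variables for the norm
`(E[F²] + E[(D^h F)²])^{1/2}`: the `F ∈ L²(Ω)` for which there are smooth `Fₙ` with `Fₙ → F` and
`D^h Fₙ` convergent, both in `L²(Ω)`. -/
def dirSobolev (W : L2Rect T →ₗ[ℝ] Lp ℝ 2 P) (h : L2Rect T) : Set (Lp ℝ 2 P) :=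
  {F | ∃ G : Lp ℝ 2 P, (F, G) ∈ closure (smoothGraph W h)}

open Classical in
/-- The directional Malliavin derivative `D^h F` of `F ∈ 𝔻^{h,2}`: the `L²(Ω)`-limit of `D^h Fₙ`
along smooth `Fₙ → F` for which it exists (under `IsGaussianNoise` and completeness of `P` it does
not depend on the `Fₙ`, since `D^h` is closable). It is `0` by convention outside `𝔻^{h,2}`. -/
def dirDeriv (W : L2Rect T →ₗ[ℝ] Lp ℝ 2 P) (h : L2Rect T) (F : Lp ℝ 2 P) : Lp ℝ 2 P :=
  if hF : ∃ G : Lp ℝ 2 P, (F, G) ∈ closure (smoothGraph W h) then hF.choose else 0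

end Malliavin

end

/-!
The proof is functional analysis resting on two facts about the graph of `D^h`, the closure of
`smoothGraph W h` in `L²(Ω) × L²(Ω)`: it is convex, and it is the graph of a function. The sequence
`D^h F_N` stays in a ball of `L²(Ω)`, which is weakly compact. A convex set that is closed in norm
is weakly closed, so if `G` is a weak cluster point of `D^h F_N`, then `(F, G)` lies in the closed
graph. Hence `F ∈ 𝔻^{h,2}` and `G = D^h F` is the only cluster point, which by compactness is weak
convergence of the whole sequence (`Convex.exists_mem_tendsto_toWeakSpace_of_bounded`).

Convexity (`convex_closure_smoothGraph`): functions with compact support cannot be added after being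
placed in separate groups of variables, but bounded smooth functions with bounded derivative can,
and a cut-off shows that these give the same closure.

Closability (`IsGaussianNoise.closure_smoothGraph_unique`): Gaussian integration by parts gives
`E[D^h F · φ] = E[F · (φ W(h) - D^h φ)]` for `φ = cos (W(g) + c)`, an identity that passes to the
closure and determines `E[D^h F · φ]` by `F`. These `φ` separate the elements of `L²(Ω)`, because
the characteristic functions of the finite-dimensional projections determine a finite measure on
`σ{W(g)}`, and `σ{W(g)}` is the whole σ-algebra up to null sets. The integration by parts itself
splits each `W(kᵢ)` into its component along `W(h)` and an independent remainder, which reduces it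
to Stein's identity on the line (`integral_id_mul_gaussianReal`).
-/

/-! ### Weak limits in convex closed graphs -/

/-- Closed balls of a real Hilbert space are weakly compact: the Riesz isomorphism carries the
weak-* compact ball of the dual onto them. -/
theorem isCompact_toWeakSpace_closedBall {E : Type*} [NormedAddCommGroup E]
    [InnerProductSpace ℝ E] [CompleteSpace E] (R : ℝ) :
    IsCompact (toWeakSpace ℝ E '' Metric.closedBall (0 : E) R) := by
  have hc : Continuous fun x' : WeakDual ℝ E =>
      toWeakSpace ℝ E ((InnerProductSpace.toDual ℝ E).symm (WeakDual.toStrongDual x')) := by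
    refine WeakBilin.continuous_of_continuous_eval _ fun ℓ => ?_
    have h : ∀ x' : WeakDual ℝ E,
        ℓ ((InnerProductSpace.toDual ℝ E).symm (WeakDual.toStrongDual x')) =
          x' ((InnerProductSpace.toDual ℝ E).symm ℓ) := by
      intro x'
      rw [← InnerProductSpace.toDual_symm_apply (y := ℓ), real_inner_comm,
        InnerProductSpace.toDual_symm_apply]
      rfl
    refine (WeakDual.eval_continuous ((InnerProductSpace.toDual ℝ E).symm ℓ)).congr fun x' => ?_
    exact (h x').symm
  have hK := (WeakDual.isCompact_closedBall (𝕜 := ℝ) (E := E) 0 R).image hc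
  refine hK.of_isClosed_subset ?_ ?_
  · rw [← (Metric.isClosed_closedBall (x := (0 : E)) (ε := R)).closure_eq,
      (convex_closedBall (0 : E) R).toWeakSpace_closure ℝ]
    exact isClosed_closure
  · rintro _ ⟨x, hx, rfl⟩
    refine ⟨StrongDual.toWeakDual (InnerProductSpace.toDual ℝ E x), ?_, ?_⟩
    · simpa using hx
    · simp

/-- A norm-closed convex subset of `E × E` is closed under norm convergence in the first component
combined with weak convergence in the second. -/
theorem Convex.mem_of_tendsto_of_tendsto_toWeakSpace {E : Type*} [NormedAddCommGroup E]
    [NormedSpace ℝ E] {C : Set (E × E)} (hconv : Convex ℝ C) (hclosed : IsClosed C)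
    {ι : Type*} {l : Filter ι} [l.NeBot] {x : ι → E} {y : ι → E} {a b : E}
    (hmem : ∀ i, (x i, y i) ∈ C) (hx : Tendsto x l (𝓝 a))
    (hy : Tendsto (fun i => toWeakSpace ℝ E (y i)) l (𝓝 (toWeakSpace ℝ E b))) :
    (a, b) ∈ C := by
  have hw : IsClosed (toWeakSpace ℝ (E × E) '' C) := by
    rw [← hclosed.closure_eq, hconv.toWeakSpace_closure ℝ]
    exact isClosed_closure
  have ht : Tendsto (fun i => toWeakSpace ℝ (E × E) (x i, y i)) l
      (𝓝 (toWeakSpace ℝ (E × E) (a, b))) := by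
    have h1 : Tendsto (fun i => toWeakSpace ℝ (E × E) (x i, 0)) l
        (𝓝 (toWeakSpace ℝ (E × E) (a, 0))) :=
      ((toWeakSpaceCLM ℝ (E × E)).continuous.tendsto _).comp (hx.prodMk_nhds tendsto_const_nhds)
    have h2 : Tendsto (fun i => toWeakSpace ℝ (E × E) (0, y i)) l
        (𝓝 (toWeakSpace ℝ (E × E) (0, b))) :=
      ((WeakSpace.map (ContinuousLinearMap.inr ℝ E E)).continuous.tendsto _).comp hy
    simpa [← map_add] using h1.add h2
  obtain ⟨p, hp, hpe⟩ := hw.mem_of_tendsto ht (Eventually.of_forall fun i => ⟨_, hmem i, rfl⟩)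
  rwa [← (toWeakSpace ℝ (E × E)).injective hpe]

/-- If the graph of a (partially defined) operator is closed and convex, then along a norm
convergent sequence with bounded images the images converge weakly to the image of the limit:
the images stay in a weakly compact ball, and each of their weak cluster points lies over the
limit. -/
theorem Convex.exists_mem_tendsto_toWeakSpace_of_bounded {E : Type*} [NormedAddCommGroup E]
    [InnerProductSpace ℝ E] [CompleteSpace E] {C : Set (E × E)} (hconv : Convex ℝ C)
    (hclosed : IsClosed C) (huniq : ∀ x y y', (x, y) ∈ C → (x, y') ∈ C → y = y')
    {x y : ℕ → E} {a : E} {R : ℝ} (hmem : ∀ n, (x n, y n) ∈ C) (hx : Tendsto x atTop (𝓝 a))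
    (hy : ∀ n, ‖y n‖ ≤ R) :
    ∃ b, (a, b) ∈ C ∧
      Tendsto (fun n => toWeakSpace ℝ E (y n)) atTop (𝓝 (toWeakSpace ℝ E b)) := by
  have hK := isCompact_toWeakSpace_closedBall (E := E) R
  have hyK : ∀ n, toWeakSpace ℝ E (y n) ∈ toWeakSpace ℝ E '' Metric.closedBall (0 : E) R :=
    fun n => ⟨y n, by simpa using hy n, rfl⟩
  have hcl : ∀ b : E, MapClusterPt (toWeakSpace ℝ E b) atTop (fun n => toWeakSpace ℝ E (y n)) →
      (a, b) ∈ C := by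
    intro b hb
    obtain ⟨U, hU, hUb⟩ := mapClusterPt_iff_ultrafilter.1 hb
    exact hconv.mem_of_tendsto_of_tendsto_toWeakSpace hclosed hmem (hx.mono_left hU) hUb
  obtain ⟨_, ⟨b, -, rfl⟩, hb⟩ := hK.exists_mapClusterPt_of_frequently
    (Frequently.of_forall (f := atTop) hyK)
  refine ⟨b, hcl b hb, hK.tendsto_nhds_of_unique_mapClusterPt (Eventually.of_forall hyK) ?_⟩
  rintro _ ⟨b', -, rfl⟩ hb'
  rw [huniq a b' b (hcl b' hb') (hcl b hb)]

/-! ### Gaussian integration by parts -/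

/-- Gaussian integration by parts on the line (Stein's identity). -/
theorem integral_id_mul_gaussianReal {v : NNReal} (hv : v ≠ 0) {u u' : ℝ → ℝ} {C : ℝ}
    (hu : ∀ x, HasDerivAt u (u' x) x) (hb : ∀ x, |u x| ≤ C) (hb' : ∀ x, |u' x| ≤ C) :
    ∫ x, x * u x ∂gaussianReal 0 v = v * ∫ x, u' x ∂gaussianReal 0 v := by
  have hv' : (v : ℝ) ≠ 0 := by exact_mod_cast hv
  set p := gaussianPDFReal 0 v with hp
  have hpd : ∀ x, HasDerivAt p (-(x / v) * p x) x := by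
    intro x
    have h1 : HasDerivAt (fun x : ℝ => -(x - 0) ^ 2 / (2 * v)) (-(x / v)) x := by
      have := (((hasDerivAt_id x).sub_const (0 : ℝ)).pow 2).neg.div_const (2 * (v : ℝ))
      refine this.congr_deriv ?_
      simp only [id]
      field_simp
      norm_num [mul_comm]
    have h2 := h1.exp.const_mul (√(2 * Real.pi * v))⁻¹
    refine h2.congr_deriv ?_
    rw [hp, gaussianPDFReal]
    ring
  have hum : AEStronglyMeasurable u (volume : Measure ℝ) :=
    (continuous_iff_continuousAt.2 fun x => (hu x).continuousAt).aestronglyMeasurable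
  have hum' : AEStronglyMeasurable u' (volume : Measure ℝ) := by
    have : u' = deriv u := funext fun x => (hu x).deriv.symm
    rw [this]
    exact (measurable_deriv u).aestronglyMeasurable
  have hpi : Integrable p := integrable_gaussianPDFReal 0 v
  have hxp : Integrable fun x => x * p x := by
    have h : Integrable id (gaussianReal 0 v) := (memLp_id_gaussianReal 1).integrable le_rfl
    rw [gaussianReal_of_var_ne_zero _ hv, integrable_withDensity_iff_integrable_smul'
      (by fun_prop) (Eventually.of_forall fun _ => gaussianPDF_lt_top)] at h
    simpa [mul_comm] using h
  have i1 : Integrable fun x => u' x * p x :=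
    hpi.bdd_mul hum' (Eventually.of_forall hb')
  have i2 : Integrable fun x => u x * (x * p x) :=
    hxp.bdd_mul hum (Eventually.of_forall hb)
  have i3 : Integrable fun x => u x * p x :=
    hpi.bdd_mul hum (Eventually.of_forall hb)
  have key := integral_eq_zero_of_hasDerivAt_of_integrable (f := fun x => u x * p x)
    (f' := fun x => u' x * p x - (v : ℝ)⁻¹ * (u x * (x * p x)))
    (fun x => ((hu x).mul (hpd x)).congr_deriv (by ring)) (i1.sub (i2.const_mul _)) i3
  rw [integral_sub i1 (i2.const_mul _), integral_const_mul, sub_eq_zero] at key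
  rw [integral_gaussianReal_eq_integral_smul hv, integral_gaussianReal_eq_integral_smul hv]
  simp only [smul_eq_mul]
  have e1 : ∫ x, gaussianPDFReal 0 v x * (x * u x) = ∫ x, u x * (x * p x) :=
    integral_congr_ae (Eventually.of_forall fun x => by simp only [hp]; ring)
  have e2 : ∫ x, gaussianPDFReal 0 v x * u' x = ∫ x, u' x * p x :=
    integral_congr_ae (Eventually.of_forall fun x => by simp only [hp]; ring)
  rw [e1, e2, key]
  field_simp

section

variable {Ω : Type*} [MeasurableSpace Ω] {P : Measure Ω} {T : ℝ} {W : L2Rect T →ₗ[ℝ] Lp ℝ 2 P}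

theorem map_sum_smul_ae {ι : Type*} [Fintype ι] (W : L2Rect T →ₗ[ℝ] Lp ℝ 2 P) (b : ι → ℝ)
    (k : ι → L2Rect T) : W (∑ i, b i • k i) =ᵐ[P] fun ω => ∑ i, b i * W (k i) ω := by
  rw [map_sum]
  simp only [map_smul]
  have h : ∀ᵐ ω ∂P, ∀ i, (b i • W (k i) : Lp ℝ 2 P) ω = b i * W (k i) ω :=
    ae_all_iff.2 fun i => Lp.coeFn_smul (b i) (W (k i))
  filter_upwards [Lp.coeFn_fun_finsetSum Finset.univ fun i => b i • W (k i), h] with ω h1 h2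
  rw [h1]
  exact Finset.sum_congr rfl fun i _ => h2 i

/-- A continuous linear form of finitely many `W (k i)` is again a value of `W`. -/
theorem strongDual_comp_ae {ι : Type*} [Fintype ι] [DecidableEq ι] (W : L2Rect T →ₗ[ℝ] Lp ℝ 2 P)
    (L : StrongDual ℝ (ι → ℝ)) (k : ι → L2Rect T) :
    (fun ω => L fun i => W (k i) ω) =ᵐ[P] W (∑ i, L (Pi.single i 1) • k i) := by
  filter_upwards [map_sum_smul_ae W (fun i => L (Pi.single i 1)) k] with ω h
  rw [h]
  conv_lhs => rw [pi_eq_sum_univ' (fun i => W (k i) ω), map_sum]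
  refine Finset.sum_congr rfl fun i _ => ?_
  rw [map_smul, smul_eq_mul, mul_comm]

variable (hW : IsGaussianNoise P W)
include hW

theorem IsGaussianNoise.isProbabilityMeasure : IsProbabilityMeasure P :=
  (hW.gaussian 0).isProbabilityMeasure

theorem IsGaussianNoise.covariance_eq (g k : L2Rect T) :
    cov[W g, W k; P] = inner ℝ g k := by
  have := hW.isProbabilityMeasure
  rw [covariance_eq_sub (Lp.memLp _) (Lp.memLp _), hW.centered, zero_mul, sub_zero]
  exact hW.covariance g k

theorem IsGaussianNoise.map_eq (g : L2Rect T) :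
    P.map (W g) = gaussianReal 0 (‖g‖ ^ 2).toNNReal := by
  have := hW.isProbabilityMeasure
  rw [(hW.gaussian g).map_eq_gaussianReal, hW.centered,
    ← covariance_self (Lp.aestronglyMeasurable _).aemeasurable, hW.covariance_eq,
    real_inner_self_eq_norm_sq]

/-- `W g` and `(W (k i))ᵢ` are independent as soon as `g` is orthogonal to every `k i`. -/
theorem IsGaussianNoise.indepFun {n : ℕ} (g : L2Rect T) (k : Fin n → L2Rect T)
    (hgk : ∀ i, inner ℝ g (k i) = 0) :
    IndepFun (W g) (fun ω i => W (k i) ω) P := by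
  have := hW.isProbabilityMeasure
  have hm : ∀ g, AEMeasurable (W g) P := fun g => (Lp.aestronglyMeasurable _).aemeasurable
  have hmk : AEMeasurable (fun ω i => W (k i) ω) P := aemeasurable_pi_lambda _ fun i => hm _
  have hfst : ∀ L : StrongDual ℝ ℝ, (fun ω => L (W g ω)) =ᵐ[P] W (L 1 • g) := by
    intro L
    filter_upwards [Lp.coeFn_smul (L 1) (W g)] with ω h
    rw [map_smul, h, Pi.smul_apply, smul_eq_mul]
    conv_lhs => rw [← mul_one (W g ω), ← smul_eq_mul, map_smul, smul_eq_mul, mul_comm]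
  refine HasGaussianLaw.indepFun_of_covariance_strongDual ⟨?_⟩ fun L₁ L₂ => ?_
  · refine isGaussian_of_isGaussian_map fun L => ?_
    rw [AEMeasurable.map_map_of_aemeasurable (by fun_prop) ((hm g).prodMk hmk)]
    have e : L ∘ (fun ω => (W g ω, fun i => W (k i) ω)) =ᵐ[P]
        W (L.comp (.inl ℝ ℝ _) 1 • g +
          ∑ i, L.comp (.inr ℝ ℝ (Fin n → ℝ)) (Pi.single i 1) • k i) := by
      rw [map_add]
      filter_upwards [hfst (L.comp (.inl ℝ ℝ _)), strongDual_comp_ae W (L.comp (.inr ℝ ℝ _)) k,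
        Lp.coeFn_add (W (L.comp (.inl ℝ ℝ _) 1 • g))
          (W (∑ i, L.comp (.inr ℝ ℝ (Fin n → ℝ)) (Pi.single i 1) • k i))] with ω h1 h2 h3
      rw [h3, Pi.add_apply, ← h1, ← h2]
      simp [← map_add]
    exact ((hW.gaussian _).congr e.symm).isGaussian_map
  · have e : cov[L₁ ∘ W g, L₂ ∘ (fun ω i => W (k i) ω); P] =
        cov[W (L₁ 1 • g), W (∑ i, L₂ (Pi.single i 1) • k i); P] := by
      have h1 := hfst L₁
      have h2 := strongDual_comp_ae W L₂ k
      simp only [ProbabilityTheory.covariance, Function.comp_def]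
      rw [integral_congr_ae h1, integral_congr_ae h2]
      refine integral_congr_ae ?_
      filter_upwards [h1, h2] with ω h1 h2
      rw [h1, h2]
    rw [e, hW.covariance_eq, inner_smul_left, inner_sum]
    simp [inner_smul_right, hgk]

/-- Integration by parts for Gaussian noise: `E[D^h Ψ] = E[Ψ W(h)]` for a bounded function
`Ψ = ψ (W k₁, …, W kₙ)` with bounded derivative `ψ'` in the direction `(⟨kᵢ, h⟩)ᵢ`. -/
theorem IsGaussianNoise.integral_mul_eq_integral_deriv {n : ℕ} (h : L2Rect T)
    (k : Fin n → L2Rect T) {ψ ψ' : (Fin n → ℝ) → ℝ} {C : ℝ}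
    (hd : ∀ y, HasDerivAt (fun t : ℝ => ψ (y + t • fun i => inner ℝ (k i) h)) (ψ' y) 0)
    (hm : Measurable ψ) (hm' : Measurable ψ') (hb : ∀ y, |ψ y| ≤ C) (hb' : ∀ y, |ψ' y| ≤ C) :
    ∫ ω, ψ (fun i => W (k i) ω) * W h ω ∂P = ∫ ω, ψ' (fun i => W (k i) ω) ∂P := by
  have := hW.isProbabilityMeasure
  set a : Fin n → ℝ := fun i => inner ℝ (k i) h with ha
  rcases eq_or_ne h 0 with rfl | hh
  · -- For `h = 0` both sides vanish.
    have h0 : ψ' = 0 := by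
      funext y
      have e : a = 0 := by ext i; simp [ha]
      have := hd y
      simp only [e, smul_zero, add_zero] at this
      exact this.unique (hasDerivAt_const _ _)
    rw [map_zero, h0]
    rw [integral_congr_ae (g := fun _ => 0)]
    · simp
    · filter_upwards [Lp.coeFn_zero ℝ 2 P] with ω hω
      rw [hω, Pi.zero_apply, mul_zero]
  have hn : ‖h‖ ^ 2 ≠ 0 := by simpa using hh
  have hv : (‖h‖ ^ 2).toNNReal ≠ 0 := by
    rw [Ne, Real.toNNReal_eq_zero, not_le]; positivity
  -- The components of the `k i` orthogonal to `h` give a vector independent of `W h`.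
  set b : Fin n → ℝ := fun i => a i / ‖h‖ ^ 2 with hbdef
  set l : Fin n → L2Rect T := fun i => k i - b i • h with hl
  have hdecomp : ∀ᵐ ω ∂P, (fun i => W (k i) ω) = (fun i => W (l i) ω) + W h ω • b := by
    have : ∀ᵐ ω ∂P, ∀ i, W (k i) ω = W (l i) ω + b i * W h ω := by
      refine ae_all_iff.2 fun i => ?_
      have e : W (l i) = W (k i) - b i • W h := by simp [hl]
      rw [e]
      filter_upwards [Lp.coeFn_sub (W (k i)) (b i • W h), Lp.coeFn_smul (b i) (W h)] with ω h1 h2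
      rw [h1, Pi.sub_apply, h2]
      simp
    filter_upwards [this] with ω hω
    ext i
    simp [hω i, mul_comm]
  have hind : IndepFun (W h) (fun ω i => W (l i) ω) P := by
    refine hW.indepFun h l fun i => ?_
    simp only [hl, hbdef, ha, inner_sub_right, inner_smul_right, real_inner_self_eq_norm_sq]
    rw [real_inner_comm]
    field_simp
    ring
  have hmW : ∀ g, AEMeasurable (W g) P := fun g => (Lp.aestronglyMeasurable _).aemeasurable
  have hml : AEMeasurable (fun ω i => W (l i) ω) P := aemeasurable_pi_lambda _ fun i => hmW _
  set ν := P.map fun ω i => W (l i) ω with hν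
  have : IsProbabilityMeasure ν := Measure.isProbabilityMeasure_map hml
  set γ := gaussianReal 0 (‖h‖ ^ 2).toNNReal with hγ
  -- By independence the expectations become iterated integrals, in which Stein's identity applies
  -- to the Gaussian variable `W h` for each fixed value of the remainder.
  have hlaw : P.map (fun ω => (W h ω, fun i => W (l i) ω)) = γ.prod ν := by
    rw [(indepFun_iff_map_prod_eq_prod_map_map (hmW h) hml).1 hind, hW.map_eq]
  have hcomb : Measurable fun z : ℝ × (Fin n → ℝ) => z.2 + z.1 • b := by fun_prop
  have hdx : ∀ (y : Fin n → ℝ) (x : ℝ),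
      HasDerivAt (fun x : ℝ => ψ (y + x • b)) ((‖h‖ ^ 2)⁻¹ * ψ' (y + x • b)) x := by
    intro y x
    have h1 : HasDerivAt (fun s : ℝ => (s - x) * (‖h‖ ^ 2)⁻¹) ((‖h‖ ^ 2)⁻¹) x := by
      simpa using ((hasDerivAt_id x).sub_const x).mul_const ((‖h‖ ^ 2)⁻¹)
    have h2 := hd (y + x • b)
    have h3 := HasDerivAt.comp_of_eq x h2 h1 (by simp)
    rw [mul_comm]
    refine h3.congr_of_eventuallyEq (Eventually.of_forall fun s => ?_)
    simp only [Function.comp]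
    congr 1
    ext i
    simp only [Pi.add_apply, Pi.smul_apply, smul_eq_mul, hbdef]
    ring
  have hint : Integrable (fun z : ℝ × (Fin n → ℝ) => z.1 * ψ (z.2 + z.1 • b)) (γ.prod ν) := by
    have h1 : Integrable (fun z : ℝ × (Fin n → ℝ) => z.1) (γ.prod ν) :=
      ((memLp_id_gaussianReal 1).integrable le_rfl).comp_fst ν
    exact h1.mul_bdd (hm.comp hcomb).aestronglyMeasurable (Eventually.of_forall fun z => hb _)
  have hint' : Integrable (fun z : ℝ × (Fin n → ℝ) => ψ' (z.2 + z.1 • b)) (γ.prod ν) :=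
    Integrable.of_bound (hm'.comp hcomb).aestronglyMeasurable C (Eventually.of_forall fun z => hb' _)
  have hmp := (hmW h).prodMk hml
  calc ∫ ω, ψ (fun i => W (k i) ω) * W h ω ∂P
      = ∫ ω, (fun z : ℝ × (Fin n → ℝ) => z.1 * ψ (z.2 + z.1 • b))
          (W h ω, fun i => W (l i) ω) ∂P := by
        refine integral_congr_ae ?_
        filter_upwards [hdecomp] with ω hω
        rw [hω, mul_comm]
    _ = ∫ z, z.1 * ψ (z.2 + z.1 • b) ∂(γ.prod ν) := by
        rw [← hlaw, integral_map hmp (hlaw ▸ hint.aestronglyMeasurable)]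
    _ = ∫ y, ∫ x, x * ψ (y + x • b) ∂γ ∂ν := integral_prod_symm _ hint
    _ = ∫ y, ∫ x, ψ' (y + x • b) ∂γ ∂ν := by
        refine integral_congr_ae (Eventually.of_forall fun y => ?_)
        have hC : 0 ≤ C := (abs_nonneg _).trans (hb 0)
        have h1 := integral_id_mul_gaussianReal hv (hdx y) (C := max C ((‖h‖ ^ 2)⁻¹ * C))
          (fun x => (hb _).trans (le_max_left _ _)) (fun x => by
            rw [abs_mul, abs_of_nonneg (by positivity)]
            exact (mul_le_mul_of_nonneg_left (hb' _) (by positivity)).trans (le_max_right _ _))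
        simp only
        rw [h1, integral_const_mul, Real.coe_toNNReal _ (by positivity), mul_inv_cancel_left₀ hn]
    _ = ∫ z, ψ' (z.2 + z.1 • b) ∂(γ.prod ν) := (integral_prod_symm _ hint').symm
    _ = ∫ ω, (fun z : ℝ × (Fin n → ℝ) => ψ' (z.2 + z.1 • b)) (W h ω, fun i => W (l i) ω) ∂P := by
        rw [← hlaw, integral_map hmp (hlaw ▸ hint'.aestronglyMeasurable)]
    _ = ∫ ω, ψ' (fun i => W (k i) ω) ∂P := by
        refine integral_congr_ae ?_
        filter_upwards [hdecomp] with ω hω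
        rw [hω]

end

/-! ### Trigonometric functions of the noise separate `L²(Ω)` -/

section

variable {Ω : Type*} [MeasurableSpace Ω] {P : Measure Ω} {T : ℝ} {W : L2Rect T →ₗ[ℝ] Lp ℝ 2 P}

/-- Two finite measures on a product of real lines agree as soon as the characteristic functions
of all their finite-dimensional projections agree. -/
theorem MeasureTheory.Measure.ext_of_charFunDual_restrict {ι : Type*}
    {μ ν : Measure (ι → ℝ)} [IsFiniteMeasure μ] [IsFiniteMeasure ν]
    (h : ∀ (J : Finset ι) (L : StrongDual ℝ (J → ℝ)),
      charFunDual (μ.map J.restrict) L = charFunDual (ν.map J.restrict) L) : μ = ν := by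
  refine IsProjectiveLimit.unique (P := fun J => ν.map J.restrict) (fun J => ?_) fun J => rfl
  exact Measure.ext_of_charFunDual (funext (h J))

/-- A square integrable random variable orthogonal to all `cos (W g + c)` vanishes: its positive
and negative parts are densities of finite measures under which the process `W` has the same
finite-dimensional characteristic functions, and `W` generates the σ-algebra up to null sets. -/
theorem IsGaussianNoise.eq_zero_of_integral_mul_cos (hW : IsGaussianNoise P W) (G : Lp ℝ 2 P)
    (hG : ∀ (g : L2Rect T) (c : ℝ), ∫ ω, G ω * Real.cos (W g ω + c) ∂P = 0) : G = 0 := by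
  have := hW.isProbabilityMeasure
  have hGi : Integrable G P := (Lp.memLp G).integrable one_le_two
  have hGm : Measurable G := (Lp.stronglyMeasurable G).measurable
  have hWm : ∀ g, Measurable (W g) := fun g => (Lp.stronglyMeasurable _).measurable
  set Φ : Ω → L2Rect T → ℝ := fun ω g => W g ω with hΦ
  have hΦm : Measurable Φ := measurable_pi_lambda _ hWm
  set μ₁ := P.withDensity fun ω => ENNReal.ofReal (G ω) with hμ₁
  set μ₂ := P.withDensity fun ω => ENNReal.ofReal (-G ω) with hμ₂
  have hf₁ : IsFiniteMeasure μ₁ := isFiniteMeasure_withDensity_ofReal hGi.2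
  have hf₂ : IsFiniteMeasure μ₂ := isFiniteMeasure_withDensity_ofReal hGi.neg.2
  have hexp : ∀ g, ∫ ω, Complex.exp (W g ω * Complex.I) ∂μ₁ =
      ∫ ω, Complex.exp (W g ω * Complex.I) ∂μ₂ := by
    intro g
    have hme : Measurable fun ω => Complex.exp (W g ω * Complex.I) := by
      have := hWm g
      fun_prop
    have hbd : ∀ᵐ ω ∂P, ‖Complex.exp (W g ω * Complex.I)‖ ≤ 1 :=
      Eventually.of_forall fun ω => (Complex.norm_exp_ofReal_mul_I _).le
    rw [hμ₁, hμ₂, integral_withDensity_eq_integral_toReal_smul (by fun_prop)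
      (Eventually.of_forall fun _ => ENNReal.ofReal_lt_top),
      integral_withDensity_eq_integral_toReal_smul (by fun_prop)
      (Eventually.of_forall fun _ => ENNReal.ofReal_lt_top), ← sub_eq_zero, ← integral_sub]
    · have hcos : Integrable (fun ω => G ω * Real.cos (W g ω + 0)) P :=
        hGi.mul_bdd (c := 1) (by have := hWm g; fun_prop)
          (Eventually.of_forall fun ω => Real.abs_cos_le_one _)
      -- The phase shift `-π/2` turns the cosine into the sine needed for the imaginary part.
      have hsin : Integrable (fun ω => G ω * Real.cos (W g ω + -(Real.pi / 2))) P :=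
        hGi.mul_bdd (c := 1) (by have := hWm g; fun_prop)
          (Eventually.of_forall fun ω => Real.abs_cos_le_one _)
      have e : ∀ ω, (ENNReal.ofReal (G ω)).toReal • Complex.exp (W g ω * Complex.I) -
          (ENNReal.ofReal (-G ω)).toReal • Complex.exp (W g ω * Complex.I) =
          ((G ω * Real.cos (W g ω + 0) : ℝ) : ℂ) +
            ((G ω * Real.cos (W g ω + -(Real.pi / 2)) : ℝ) : ℂ) * Complex.I := by
        intro ω
        rw [← sub_smul, ENNReal.toReal_ofReal', ENNReal.toReal_ofReal',
          max_zero_sub_max_neg_zero_eq_self, Complex.exp_mul_I,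
          ← sub_eq_add_neg, Real.cos_sub_pi_div_two, add_zero, Complex.real_smul]
        push_cast
        ring
      simp_rw [e]
      rw [integral_add hcos.ofReal (hsin.ofReal.mul_const _), integral_mul_const,
        integral_complex_ofReal, integral_complex_ofReal, hG, hG]
      simp
    · exact (hGi.real_toNNReal).smul_bdd 1 hme.aestronglyMeasurable hbd
    · exact (hGi.neg.real_toNNReal).smul_bdd 1 hme.aestronglyMeasurable hbd
  have hchar : μ₁.map Φ = μ₂.map Φ := by
    classical
    refine Measure.ext_of_charFunDual_restrict fun J L => ?_
    have hJ : Measurable (J.restrict : (L2Rect T → ℝ) → J → ℝ) := by fun_prop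
    have e : ∀ᵐ ω ∂P, L (fun j : J => W j ω) =
        W (∑ j : J, L (Pi.single j 1) • (j : L2Rect T)) ω :=
      strongDual_comp_ae W L fun j : J => (j : L2Rect T)
    have hc : ∀ μ : Measure Ω, μ ≪ P → charFunDual ((μ.map Φ).map J.restrict) L =
        ∫ ω, Complex.exp (W (∑ j : J, L (Pi.single j 1) • (j : L2Rect T)) ω * Complex.I) ∂μ := by
      intro μ hμ
      rw [Measure.map_map hJ hΦm, charFunDual_apply, integral_map (hJ.comp hΦm).aemeasurable
        (by fun_prop)]
      refine integral_congr_ae ?_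
      filter_upwards [hμ.ae_le e] with ω hω
      rw [← hω]
      rfl
    rw [hc μ₁ (withDensity_absolutelyContinuous _ _), hc μ₂ (withDensity_absolutelyContinuous _ _),
      hexp]
  have hset : ∀ A, MeasurableSet A → ∫ ω in A, G ω ∂P = 0 := by
    intro A hA
    obtain ⟨B, hB, hAB⟩ := hW.generated A hA
    have hB' : MeasurableSet[MeasurableSpace.comap Φ MeasurableSpace.pi] B := by
      have e : MeasurableSpace.comap Φ MeasurableSpace.pi =
          ⨆ g, MeasurableSpace.comap (W g : Ω → ℝ) (inferInstance : MeasurableSpace ℝ) := by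
        rw [MeasurableSpace.pi, MeasurableSpace.comap_iSup]
        exact iSup_congr fun g => MeasurableSpace.comap_comp
      rw [e]
      exact hB
    obtain ⟨S, hS, rfl⟩ := hB'
    have hBm := hΦm hS
    have hμ : μ₁ (Φ ⁻¹' S) = μ₂ (Φ ⁻¹' S) := by
      rw [← Measure.map_apply hΦm hS, hchar, Measure.map_apply hΦm hS]
    rw [setIntegral_congr_set hAB,
      integral_eq_lintegral_pos_part_sub_lintegral_neg_part hGi.integrableOn,
      ← withDensity_apply _ hBm, ← withDensity_apply _ hBm, ← hμ₁, ← hμ₂, hμ, sub_self]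
  have h0 : (G : Ω → ℝ) =ᵐ[P] 0 :=
    hGi.ae_eq_zero_of_forall_setIntegral_eq_zero fun A hA _ => hset A hA
  exact (Lp.eq_zero_iff_ae_eq_zero).2 h0

end

/-! ### Convexity of the graph of the directional derivative -/

section

variable {Ω : Type*} [MeasurableSpace Ω] {P : Measure Ω} {T : ℝ} {W : L2Rect T →ₗ[ℝ] Lp ℝ 2 P}

theorem inner_cylinderDeriv {n : ℕ} (f : (Fin n → ℝ) → ℝ) (k : Fin n → L2Rect T) (h : L2Rect T)
    (ω : Ω) : inner ℝ (cylinderDeriv W f k ω) h =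
      fderiv ℝ f (fun i => W (k i) ω) (fun i => inner ℝ (k i) h) := by
  rw [cylinderDeriv, sum_inner]
  conv_rhs => rw [pi_eq_sum_univ' (fun i => inner ℝ (k i) h), map_sum]
  refine Finset.sum_congr rfl fun i _ => ?_
  rw [map_smul, inner_smul_left, smul_eq_mul, mul_comm]
  rfl

theorem aemeasurable_noise_pi (W : L2Rect T →ₗ[ℝ] Lp ℝ 2 P) {n : ℕ} (k : Fin n → L2Rect T) :
    AEMeasurable (fun ω i => W (k i) ω) P :=
  aemeasurable_pi_lambda _ fun _ => (Lp.aestronglyMeasurable _).aemeasurable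

/-- Bounded convergence in `L²` of a finite measure. -/
theorem MeasureTheory.MemLp.tendsto_toLp_of_bounded [IsFiniteMeasure P] {u : ℕ → Ω → ℝ}
    {v : Ω → ℝ} {C : ℝ} (hu : ∀ m, MemLp (u m) 2 P) (hv : MemLp v 2 P)
    (hb : ∀ m ω, |u m ω| ≤ C) (hlim : ∀ ω, Tendsto (fun m => u m ω) atTop (𝓝 (v ω))) :
    Tendsto (fun m => (hu m).toLp (u m)) atTop (𝓝 (hv.toLp v)) := by
  have hbv : ∀ ω, |v ω| ≤ C := fun ω => le_of_tendsto (hlim ω).abs (Eventually.of_forall (hb · ω))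
  have hsq : ∀ m, ‖(hu m).toLp (u m) - hv.toLp v‖ ^ 2 = ∫ ω, (u m ω - v ω) ^ 2 ∂P := by
    intro m
    rw [← MemLp.toLp_sub, ← real_inner_self_eq_norm_sq, L2.inner_def]
    refine integral_congr_ae ?_
    filter_upwards [((hu m).sub hv).coeFn_toLp] with ω hω
    simp [hω, sq]
  rw [tendsto_iff_norm_sub_tendsto_zero]
  have h0 : Tendsto (fun m => ∫ ω, (u m ω - v ω) ^ 2 ∂P) atTop (𝓝 (∫ _, (0 : ℝ) ∂P)) := by
    refine tendsto_integral_of_dominated_convergence (fun _ => (2 * C) ^ 2)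
      (fun m => (((hu m).sub hv).1.pow 2)) (integrable_const _) (fun m => ?_) ?_
    · refine Eventually.of_forall fun ω => ?_
      rw [Real.norm_eq_abs, abs_of_nonneg (sq_nonneg _), sq_le_sq]
      have h1 := abs_sub (u m ω) (v ω)
      have h2 := hb m ω
      have h3 := hbv ω
      exact (by linarith : |u m ω - v ω| ≤ 2 * C).trans (le_abs_self _)
    · refine Eventually.of_forall fun ω => ?_
      simpa using ((hlim ω).sub_const (v ω)).pow 2
  have h1 := h0.sqrt
  simp only [integral_zero, Real.sqrt_zero] at h1
  refine h1.congr fun m => ?_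
  rw [← hsq, Real.sqrt_sq (norm_nonneg _)]

/-- The pairs `(F, D^h F)` for `F = f (W k₁, …, W kₙ)` with `f` smooth, bounded and with bounded
derivative. Unlike compactly supported functions, such `f` can be added after being made to depend
on separate groups of variables. -/
def boundedGraph (W : L2Rect T →ₗ[ℝ] Lp ℝ 2 P) (h : L2Rect T) : Set (Lp ℝ 2 P × Lp ℝ 2 P) :=
  {p | ∃ (n : ℕ) (f : (Fin n → ℝ) → ℝ) (k : Fin n → L2Rect T) (C : ℝ),
    ContDiff ℝ ((⊤ : ℕ∞) : WithTop ℕ∞) f ∧ (∀ x, |f x| ≤ C) ∧ (∀ x, ‖fderiv ℝ f x‖ ≤ C) ∧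
    (p.1 : Ω → ℝ) =ᵐ[P] cylinderVar W f k ∧
    (p.2 : Ω → ℝ) =ᵐ[P] fun ω => inner ℝ (cylinderDeriv W f k ω) h}

theorem HasCompactSupport.exists_bound_fderiv {n : ℕ} {f : (Fin n → ℝ) → ℝ}
    (hf : ContDiff ℝ ((⊤ : ℕ∞) : WithTop ℕ∞) f) (hc : HasCompactSupport f) :
    ∃ C, (∀ x, |f x| ≤ C) ∧ ∀ x, ‖fderiv ℝ f x‖ ≤ C := by
  obtain ⟨C₁, h₁⟩ := hc.exists_bound_of_continuous hf.continuous
  obtain ⟨C₂, h₂⟩ := (hc.fderiv ℝ).exists_bound_of_continuous (hf.continuous_fderiv (by simp))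
  exact ⟨max C₁ C₂, fun x => (h₁ x).trans (le_max_left _ _),
    fun x => (h₂ x).trans (le_max_right _ _)⟩

theorem smoothGraph_subset_boundedGraph (W : L2Rect T →ₗ[ℝ] Lp ℝ 2 P) (h : L2Rect T) :
    smoothGraph W h ⊆ boundedGraph W h := by
  rintro p ⟨n, f, k, hf, hc, h1, h2⟩
  obtain ⟨C, hC, hC'⟩ := hc.exists_bound_fderiv hf
  exact ⟨n, f, k, C, hf, hC, hC', h1, h2⟩

/-- A combination of `f (W k)` and `g (W l)` is a function of `(W k, W l)`, with the two groups of
variables concatenated by `Fin.append`. -/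
theorem convex_boundedGraph (W : L2Rect T →ₗ[ℝ] Lp ℝ 2 P) (h : L2Rect T) :
    Convex ℝ (boundedGraph W h) := by
  rintro p ⟨n, f, k, C, hf, hb, hb', hp1, hp2⟩ q ⟨m, g, l, D, hg, hd, hd', hq1, hq2⟩ s t hs ht -
  let L : (Fin (n + m) → ℝ) →L[ℝ] (Fin n → ℝ) :=
    ContinuousLinearMap.pi fun i => ContinuousLinearMap.proj (Fin.castAdd m i)
  let R : (Fin (n + m) → ℝ) →L[ℝ] (Fin m → ℝ) :=
    ContinuousLinearMap.pi fun i => ContinuousLinearMap.proj (Fin.natAdd n i)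
  have hfd : ∀ x, HasFDerivAt (fun x => s * f (L x) + t * g (R x))
      (s • (fderiv ℝ f (L x)).comp L + t • (fderiv ℝ g (R x)).comp R) x := fun x =>
    (((hf.differentiable (by simp) _).hasFDerivAt.comp x L.hasFDerivAt).const_mul s).add
      (((hg.differentiable (by simp) _).hasFDerivAt.comp x R.hasFDerivAt).const_mul t)
  have hL : ∀ ω, L (fun i => W (Fin.append k l i) ω) = fun i => W (k i) ω := fun ω => by
    ext i; simp [L]
  have hR : ∀ ω, R (fun i => W (Fin.append k l i) ω) = fun i => W (l i) ω := fun ω => by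
    ext i; simp [R]
  have hL' : L (fun i => inner ℝ (Fin.append k l i) h) = fun i => inner ℝ (k i) h := by
    ext i; simp [L]
  have hR' : R (fun i => inner ℝ (Fin.append k l i) h) = fun i => inner ℝ (l i) h := by
    ext i; simp [R]
  refine ⟨n + m, fun x => s * f (L x) + t * g (R x), Fin.append k l,
    max (s * C + t * D) (s * (C * ‖L‖) + t * (D * ‖R‖)), ?_, fun x => ?_, fun x => ?_, ?_, ?_⟩
  · exact (contDiff_const.mul (hf.comp L.contDiff)).add (contDiff_const.mul (hg.comp R.contDiff))
  · refine le_trans ((abs_add_le _ _).trans ?_) (le_max_left _ _)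
    rw [abs_mul, abs_mul, abs_of_nonneg hs, abs_of_nonneg ht]
    exact add_le_add (mul_le_mul_of_nonneg_left (hb _) hs) (mul_le_mul_of_nonneg_left (hd _) ht)
  · rw [(hfd x).fderiv]
    refine le_trans ((norm_add_le _ _).trans ?_) (le_max_right _ _)
    rw [norm_smul, norm_smul, Real.norm_of_nonneg hs, Real.norm_of_nonneg ht]
    refine add_le_add (mul_le_mul_of_nonneg_left ?_ hs) (mul_le_mul_of_nonneg_left ?_ ht)
    · exact (ContinuousLinearMap.opNorm_comp_le _ _).trans
        (mul_le_mul_of_nonneg_right (hb' _) (norm_nonneg _))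
    · exact (ContinuousLinearMap.opNorm_comp_le _ _).trans
        (mul_le_mul_of_nonneg_right (hd' _) (norm_nonneg _))
  · filter_upwards [hp1, hq1, Lp.coeFn_add (s • p.1) (t • q.1), Lp.coeFn_smul s p.1,
      Lp.coeFn_smul t q.1] with ω h1 h2 h3 h4 h5
    simp only [Prod.fst_add, Prod.smul_fst, h3, Pi.add_apply, h4, h5, Pi.smul_apply, h1, h2,
      smul_eq_mul, cylinderVar, hL, hR]
  · filter_upwards [hp2, hq2, Lp.coeFn_add (s • p.2) (t • q.2), Lp.coeFn_smul s p.2,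
      Lp.coeFn_smul t q.2] with ω h1 h2 h3 h4 h5
    rw [inner_cylinderDeriv, (hfd _).fderiv, Prod.snd_add, Prod.smul_snd, Prod.smul_snd, h3,
      Pi.add_apply, h4, h5, Pi.smul_apply, Pi.smul_apply, h1, h2, inner_cylinderDeriv,
      inner_cylinderDeriv]
    simp [hL, hR, hL', hR']

/-- Cutting off at radius `m` and letting `m → ∞` approximates the bounded smooth cylinder
variables, together with their derivatives, by compactly supported ones. -/
theorem boundedGraph_subset_closure_smoothGraph [IsFiniteMeasure P]
    (W : L2Rect T →ₗ[ℝ] Lp ℝ 2 P) (h : L2Rect T) :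
    boundedGraph W h ⊆ closure (smoothGraph W h) := by
  rintro p ⟨n, f, k, C, hf, hb, hb', hp1, hp2⟩
  let χ : ContDiffBump (0 : Fin n → ℝ) := ⟨1, 2, one_pos, one_lt_two⟩
  have hχ : ContDiff ℝ ((⊤ : ℕ∞) : WithTop ℕ∞) χ := χ.contDiff
  obtain ⟨D, -, hD⟩ := χ.hasCompactSupport.exists_bound_fderiv hχ
  have hD0 : 0 ≤ D := (norm_nonneg _).trans (hD 0)
  have hC0 : 0 ≤ C := (abs_nonneg _).trans (hb 0)
  let c : ℕ → ℝ := fun m => 1 / ((m : ℝ) + 1)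
  have hc0 : ∀ m, 0 < c m := fun m => Nat.one_div_pos_of_nat
  have hc1 : ∀ m, c m ≤ 1 := fun m => by
    simp only [c]; rw [div_le_one (by positivity)]; linarith [Nat.cast_nonneg (α := ℝ) m]
  have hclim : Tendsto c atTop (𝓝 0) := tendsto_one_div_add_atTop_nhds_zero_nat
  have hcx : ∀ x : Fin n → ℝ, Tendsto (fun m => c m • x) atTop (𝓝 0) := fun x => by
    simpa using hclim.smul_const x
  have hχx : ∀ x : Fin n → ℝ, Tendsto (fun m => χ (c m • x)) atTop (𝓝 1) := fun x => by
    have := (hχ.continuous.tendsto 0).comp (hcx x)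
    rwa [χ.one_of_mem_closedBall (by simp [χ])] at this
  let F : ℕ → (Fin n → ℝ) → ℝ := fun m x => χ (c m • x) * f x
  have hFs : ∀ m, ContDiff ℝ ((⊤ : ℕ∞) : WithTop ℕ∞) (F m) := fun m =>
    (hχ.comp (contDiff_const_smul (c m))).mul hf
  have hFc : ∀ m, HasCompactSupport (F m) := fun m =>
    (χ.hasCompactSupport.comp_smul (hc0 m).ne').mul_right
  have hFd : ∀ m x a, fderiv ℝ (F m) x a =
      χ (c m • x) * fderiv ℝ f x a + c m * (f x * fderiv ℝ χ (c m • x) a) := by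
    intro m x a
    have h1 : HasFDerivAt (fun x : Fin n → ℝ => χ (c m • x))
        ((fderiv ℝ χ (c m • x)).comp (c m • ContinuousLinearMap.id ℝ (Fin n → ℝ))) x :=
      (hχ.differentiable (by simp) _).hasFDerivAt.comp x ((hasFDerivAt_id x).const_smul (c m))
    have h2 : HasFDerivAt (F m) _ x := h1.mul (hf.differentiable (by simp) x).hasFDerivAt
    rw [h2.fderiv]
    simp
    ring
  set a : Fin n → ℝ := fun i => inner ℝ (k i) h with ha
  have hWm := aemeasurable_noise_pi W k
  have hFb : ∀ m x, |F m x| ≤ C := fun m x => by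
    simp only [F]
    rw [abs_mul, abs_of_nonneg χ.nonneg]
    exact (mul_le_of_le_one_left (abs_nonneg _) χ.le_one).trans (hb x)
  have hFb' : ∀ m x, |fderiv ℝ (F m) x a| ≤ C * ‖a‖ + C * (D * ‖a‖) := fun m x => by
    have e1 : |fderiv ℝ f x a| ≤ C * ‖a‖ := (fderiv ℝ f x).le_of_opNorm_le (hb' x) a
    have e2 : |fderiv ℝ χ (c m • x) a| ≤ D * ‖a‖ := (fderiv ℝ χ _).le_of_opNorm_le (hD _) a
    rw [hFd]
    refine (abs_add_le _ _).trans (add_le_add ?_ ?_)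
    · rw [abs_mul, abs_of_nonneg χ.nonneg]
      exact (mul_le_of_le_one_left (abs_nonneg _) χ.le_one).trans e1
    · rw [abs_mul, abs_mul, abs_of_pos (hc0 m)]
      refine (mul_le_of_le_one_left (by positivity) (hc1 m)).trans ?_
      exact mul_le_mul (hb x) e2 (abs_nonneg _) hC0
  have hm1 : ∀ m, MemLp (cylinderVar W (F m) k) 2 P := fun m =>
    MemLp.of_bound ((hFs m).continuous.measurable.comp_aemeasurable hWm).aestronglyMeasurable C
      (Eventually.of_forall fun ω => hFb m _)
  have hm2 : ∀ m, MemLp (fun ω => fderiv ℝ (F m) (fun i => W (k i) ω) a) 2 P := fun m =>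
    MemLp.of_bound (((((hFs m).continuous_fderiv (by simp)).clm_apply
      continuous_const).measurable.comp_aemeasurable hWm).aestronglyMeasurable) _
      (Eventually.of_forall fun ω => hFb' m _)
  have hp1' : MemLp (cylinderVar W f k) 2 P := (memLp_congr_ae hp1).1 (Lp.memLp p.1)
  have hp2' : MemLp (fun ω => inner ℝ (cylinderDeriv W f k ω) h) 2 P :=
    (memLp_congr_ae hp2).1 (Lp.memLp p.2)
  have hpe : p = (hp1'.toLp _, hp2'.toLp _) := by
    refine Prod.ext (Lp.ext ?_) (Lp.ext ?_)
    · exact hp1.trans hp1'.coeFn_toLp.symm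
    · exact hp2.trans hp2'.coeFn_toLp.symm
  rw [hpe]
  refine mem_closure_of_tendsto (f := fun m => ((hm1 m).toLp _, (hm2 m).toLp _)) (b := atTop)
    (Tendsto.prodMk_nhds ?_ ?_) (Eventually.of_forall fun m => ?_)
  · refine MemLp.tendsto_toLp_of_bounded hm1 hp1' (fun m ω => hFb m _) fun ω => ?_
    simpa [cylinderVar, F] using (hχx fun i => W (k i) ω).mul_const (f fun i => W (k i) ω)
  · refine MemLp.tendsto_toLp_of_bounded hm2 hp2' (fun m ω => hFb' m _) fun ω => ?_
    simp only [inner_cylinderDeriv, hFd]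
    have hχ' : Tendsto (fun m => fderiv ℝ χ (c m • fun i => W (k i) ω) a) atTop
        (𝓝 (fderiv ℝ χ 0 a)) :=
      (((hχ.continuous_fderiv (by simp)).clm_apply continuous_const).tendsto 0).comp (hcx _)
    simpa using ((hχx fun i => W (k i) ω).mul_const _).add (hclim.mul (hχ'.const_mul _))
  · refine ⟨n, F m, k, hFs m, hFc m, (hm1 m).coeFn_toLp, ?_⟩
    filter_upwards [(hm2 m).coeFn_toLp] with ω hω
    rw [inner_cylinderDeriv]
    exact hω

/-- The closed graph of `D^h` is convex, being the closure of the convex set `boundedGraph W h`. -/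
theorem convex_closure_smoothGraph [IsFiniteMeasure P] (W : L2Rect T →ₗ[ℝ] Lp ℝ 2 P)
    (h : L2Rect T) : Convex ℝ (closure (smoothGraph W h)) := by
  have e : closure (smoothGraph W h) = closure (boundedGraph W h) :=
    (closure_mono (smoothGraph_subset_boundedGraph W h)).antisymm
      (closure_minimal (boundedGraph_subset_closure_smoothGraph W h) isClosed_closure)
  rw [e]
  exact (convex_boundedGraph W h).closure

end

/-! ### Closability of the directional derivative -/

section

variable {Ω : Type*} [MeasurableSpace Ω] {P : Measure Ω} {T : ℝ} {W : L2Rect T →ₗ[ℝ] Lp ℝ 2 P}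

theorem memLp_cos_noise [IsFiniteMeasure P] (W : L2Rect T →ₗ[ℝ] Lp ℝ 2 P) (g : L2Rect T) (c : ℝ) :
    MemLp (fun ω => Real.cos (W g ω + c)) 2 P := by
  have hm : AEMeasurable (W g) P := (Lp.aestronglyMeasurable _).aemeasurable
  exact MemLp.of_bound (by fun_prop) 1 (Eventually.of_forall fun ω => Real.abs_cos_le_one _)

/-- The adjoint `φ W(h) - D^h φ` of `D^h` applied to `φ = cos (W g + c)` is square integrable. -/
theorem memLp_adjoint_cos_noise [IsFiniteMeasure P] (W : L2Rect T →ₗ[ℝ] Lp ℝ 2 P) (h g : L2Rect T)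
    (c : ℝ) :
    MemLp (fun ω => Real.cos (W g ω + c) * W h ω + Real.sin (W g ω + c) * inner ℝ g h) 2 P := by
  have hm : AEMeasurable (W g) P := (Lp.aestronglyMeasurable _).aemeasurable
  refine MemLp.add ?_ (MemLp.mul_const ?_ _)
  · exact (Lp.memLp (W h)).mul (memLp_top_of_bound (by fun_prop) 1
      (Eventually.of_forall fun ω => Real.abs_cos_le_one _))
  · exact MemLp.of_bound (by fun_prop) 1 (Eventually.of_forall fun ω => Real.abs_sin_le_one _)

/-- The duality `E[D^h F · φ] = E[F · (φ W(h) - D^h φ)]` for `φ = cos (W g + c)`, obtained by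
integrating `D^h (F φ)` by parts; both sides are `L²`-continuous in `(F, D^h F)`. -/
theorem IsGaussianNoise.inner_snd_eq_inner_fst [IsFiniteMeasure P] (hW : IsGaussianNoise P W)
    {h : L2Rect T} {p : Lp ℝ 2 P × Lp ℝ 2 P} (hp : p ∈ closure (smoothGraph W h)) (g : L2Rect T)
    (c : ℝ) :
    inner ℝ p.2 ((memLp_cos_noise W g c).toLp _) =
      inner ℝ p.1 ((memLp_adjoint_cos_noise W h g c).toLp _) := by
  have hcl : IsClosed {p : Lp ℝ 2 P × Lp ℝ 2 P | inner ℝ p.2 ((memLp_cos_noise W g c).toLp _) =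
      inner ℝ p.1 ((memLp_adjoint_cos_noise W h g c).toLp _)} :=
    isClosed_eq (by fun_prop) (by fun_prop)
  refine closure_minimal (fun p hp => ?_) hcl hp
  obtain ⟨n, f, k, hf, hc, hp1, hp2⟩ := hp
  obtain ⟨C, hC, hC'⟩ := hc.exists_bound_fderiv hf
  have hC0 : 0 ≤ C := (abs_nonneg _).trans (hC 0)
  set a : Fin n → ℝ := fun i => inner ℝ (k i) h with ha
  have hb1 : ∀ x, |fderiv ℝ f x a| ≤ C * ‖a‖ := fun x => (fderiv ℝ f x).le_of_opNorm_le (hC' x) a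
  have htail : Continuous (Fin.tail : (Fin (n + 1) → ℝ) → Fin n → ℝ) :=
    continuous_pi fun i => continuous_apply i.succ
  have hcf' : Continuous fun x => fderiv ℝ f x a :=
    (hf.continuous_fderiv (by simp)).clm_apply continuous_const
  have hcf := hf.continuous
  have hWk := aemeasurable_noise_pi W k
  have hWg : AEMeasurable (W g) P := (Lp.aestronglyMeasurable _).aemeasurable
  -- `F φ` is the cylinder variable `ψ (W g, W k₁, …, W kₙ)`, and `ψ'` represents `D^h (F φ)`.
  let ψ : (Fin (n + 1) → ℝ) → ℝ := fun y => f (Fin.tail y) * Real.cos (y 0 + c)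
  let ψ' : (Fin (n + 1) → ℝ) → ℝ := fun y =>
    fderiv ℝ f (Fin.tail y) a * Real.cos (y 0 + c) -
      f (Fin.tail y) * (Real.sin (y 0 + c) * inner ℝ g h)
  have hd : ∀ y, HasDerivAt
      (fun t : ℝ => ψ (y + t • fun i => inner ℝ ((Fin.cons g k : Fin (n + 1) → L2Rect T) i) h))
      (ψ' y) 0 := by
    intro y
    have e1 : HasDerivAt (fun t : ℝ => f (Fin.tail y + t • a)) (fderiv ℝ f (Fin.tail y) a) 0 := by
      have h1 : HasDerivAt (fun t : ℝ => Fin.tail y + t • a) a 0 := by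
        simpa using ((hasDerivAt_id (0 : ℝ)).smul_const a).const_add (Fin.tail y)
      exact HasFDerivAt.comp_hasDerivAt_of_eq (0 : ℝ)
        (hf.differentiable (by simp) (Fin.tail y)).hasFDerivAt h1 (by simp)
    have e2 : HasDerivAt (fun t : ℝ => Real.cos (y 0 + t * inner ℝ g h + c))
        (-Real.sin (y 0 + c) * inner ℝ g h) 0 := by
      have h1 : HasDerivAt (fun t : ℝ => y 0 + t * inner ℝ g h + c) (inner ℝ g h) 0 := by
        simpa using
          (((hasDerivAt_id (0 : ℝ)).mul_const (inner ℝ g h : ℝ)).const_add (y 0)).add_const c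
      simpa using h1.cos
    have e3 := e1.mul e2
    refine (e3.congr_deriv ?_).congr_of_eventuallyEq (Eventually.of_forall fun t => ?_)
    · simp [ψ']
      ring
    · simp only [ψ, Pi.mul_apply]
      congr 2
  have hbψ : ∀ y, |ψ y| ≤ C := fun y => by
    simp only [ψ]
    rw [abs_mul]
    exact (mul_le_of_le_one_right (abs_nonneg _) (Real.abs_cos_le_one _)).trans (hC _)
  have hbψ' : ∀ y, |ψ' y| ≤ C * ‖a‖ + C * |inner ℝ g h| := fun y => by
    simp only [ψ']
    refine (abs_sub _ _).trans (add_le_add ?_ ?_)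
    · rw [abs_mul]
      exact (mul_le_of_le_one_right (abs_nonneg _) (Real.abs_cos_le_one _)).trans (hb1 _)
    · rw [abs_mul, abs_mul]
      exact mul_le_mul (hC _)
        (mul_le_of_le_one_left (abs_nonneg _) (Real.abs_sin_le_one _)) (by positivity) hC0
  have key := hW.integral_mul_eq_integral_deriv h (Fin.cons g k : Fin (n + 1) → L2Rect T) hd
    (by fun_prop) (by fun_prop) (fun y => (hbψ y).trans (le_max_left _ _))
    (fun y => (hbψ' y).trans (le_max_right _ _))
  have hWc : ∀ ω, (fun i => W ((Fin.cons g k : Fin (n + 1) → L2Rect T) i) ω) =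
      (Fin.cons (W g ω) fun i => W (k i) ω : Fin (n + 1) → ℝ) := by
    intro ω
    ext i
    refine Fin.cases ?_ (fun j => ?_) i <;> simp
  simp only [hWc, ψ, ψ', Fin.tail_cons, Fin.cons_zero] at key
  have i1 : Integrable (fun ω => fderiv ℝ f (fun i => W (k i) ω) a * Real.cos (W g ω + c)) P :=
    Integrable.of_bound
      ((hcf'.measurable.comp_aemeasurable hWk).mul (by fun_prop)).aestronglyMeasurable
      (C * ‖a‖) (Eventually.of_forall fun ω => by
        rw [Real.norm_eq_abs, abs_mul]
        exact (mul_le_of_le_one_right (abs_nonneg _) (Real.abs_cos_le_one _)).trans (hb1 _))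
  have i2 : Integrable (fun ω => f (fun i => W (k i) ω) *
      (Real.sin (W g ω + c) * inner ℝ g h)) P :=
    Integrable.of_bound
      ((hcf.measurable.comp_aemeasurable hWk).mul (by fun_prop)).aestronglyMeasurable
      (C * |inner ℝ g h|) (Eventually.of_forall fun ω => by
        rw [Real.norm_eq_abs, abs_mul, abs_mul]
        exact mul_le_mul (hC _)
          (mul_le_of_le_one_left (abs_nonneg _) (Real.abs_sin_le_one _)) (by positivity) hC0)
  have i3 : Integrable (fun ω => f (fun i => W (k i) ω) * Real.cos (W g ω + c) * W h ω) P :=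
    ((Lp.memLp (W h)).integrable one_le_two).bdd_mul (c := C)
      ((hcf.measurable.comp_aemeasurable hWk).mul (by fun_prop)).aestronglyMeasurable
      (Eventually.of_forall fun ω => by
        rw [Real.norm_eq_abs, abs_mul]
        exact (mul_le_of_le_one_right (abs_nonneg _) (Real.abs_cos_le_one _)).trans (hC _))
  rw [integral_sub i1 i2, eq_sub_iff_add_eq, ← integral_add i3 i2] at key
  have el : inner ℝ p.2 ((memLp_cos_noise W g c).toLp _) =
      ∫ ω, fderiv ℝ f (fun i => W (k i) ω) a * Real.cos (W g ω + c) ∂P := by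
    rw [L2.inner_def]
    refine integral_congr_ae ?_
    filter_upwards [hp2, (memLp_cos_noise W g c).coeFn_toLp] with ω h1 h2
    rw [h1, h2, inner_cylinderDeriv]
    simp [mul_comm, ha]
  have er : inner ℝ p.1 ((memLp_adjoint_cos_noise W h g c).toLp _) =
      ∫ ω, (f (fun i => W (k i) ω) * Real.cos (W g ω + c) * W h ω +
        f (fun i => W (k i) ω) * (Real.sin (W g ω + c) * inner ℝ g h)) ∂P := by
    rw [L2.inner_def]
    refine integral_congr_ae ?_
    filter_upwards [hp1, (memLp_adjoint_cos_noise W h g c).coeFn_toLp] with ω h1 h2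
    rw [h1, h2]
    simp only [cylinderVar, RCLike.inner_apply, conj_trivial]
    ring
  rw [Set.mem_ofPred_eq, el, er, key]

/-- `D^h` is closable: the closure of its graph is again the graph of a function. -/
theorem IsGaussianNoise.closure_smoothGraph_unique (hW : IsGaussianNoise P W) (h : L2Rect T)
    (F G G' : Lp ℝ 2 P) (hG : (F, G) ∈ closure (smoothGraph W h))
    (hG' : (F, G') ∈ closure (smoothGraph W h)) : G = G' := by
  have := hW.isProbabilityMeasure
  rw [← sub_eq_zero]
  refine hW.eq_zero_of_integral_mul_cos _ fun g c => ?_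
  have h0 : inner ℝ (G - G') ((memLp_cos_noise W g c).toLp _) = 0 := by
    rw [inner_sub_left, sub_eq_zero]
    exact (hW.inner_snd_eq_inner_fst hG g c).trans (hW.inner_snd_eq_inner_fst hG' g c).symm
  rw [← h0, L2.inner_def]
  refine integral_congr_ae ?_
  filter_upwards [(memLp_cos_noise W g c).coeFn_toLp] with ω hω
  rw [hω]
  simp [mul_comm]

theorem mem_closure_dirDeriv {h : L2Rect T} {F : Lp ℝ 2 P} (hF : F ∈ dirSobolev W h) :
    (F, dirDeriv W h F) ∈ closure (smoothGraph W h) := by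
  have hF' : ∃ G : Lp ℝ 2 P, (F, G) ∈ closure (smoothGraph W h) := hF
  rw [dirDeriv, dif_pos hF']
  exact hF'.choose_spec

end

theorem mainTheorem6 {Ω : Type*} [MeasurableSpace Ω] (P : Measure Ω) [IsProbabilityMeasure P]
    (hP : P.IsComplete) (T : ℝ) (hT : 0 < T)
    (W : L2Rect T →ₗ[ℝ] Lp ℝ 2 P) (hW : IsGaussianNoise P W)
    (h : L2Rect T) (F : Lp ℝ 2 P) (Fseq : ℕ → Lp ℝ 2 P)
    (hmem : ∀ N, Fseq N ∈ dirSobolev W h)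
    (hconv : Tendsto Fseq atTop (𝓝 F))
    (hbdd : BddAbove (Set.range fun N => ∫ ω, (dirDeriv W h (Fseq N) ω) ^ 2 ∂P)) :
    F ∈ dirSobolev W h ∧
      Tendsto (fun N => toWeakSpace ℝ (Lp ℝ 2 P) (dirDeriv W h (Fseq N))) atTop
        (𝓝 (toWeakSpace ℝ (Lp ℝ 2 P) (dirDeriv W h F))) := by
  obtain ⟨R, hR⟩ := hbdd
  have hnorm : ∀ N, ‖dirDeriv W h (Fseq N)‖ ≤ √R := by
    intro N
    refine Real.le_sqrt_of_sq_le ?_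
    rw [← real_inner_self_eq_norm_sq, L2.inner_def]
    refine le_of_eq_of_le ?_ (hR ⟨N, rfl⟩)
    simp [sq]
  obtain ⟨G, hG, hlim⟩ :=
    (convex_closure_smoothGraph W h).exists_mem_tendsto_toWeakSpace_of_bounded isClosed_closure
      (hW.closure_smoothGraph_unique h) (fun N => mem_closure_dirDeriv (hmem N)) hconv hnorm
  have hF : F ∈ dirSobolev W h := ⟨G, hG⟩
  refine ⟨hF, ?_⟩
  rwa [hW.closure_smoothGraph_unique h F _ G (mem_closure_dirDeriv hF) hG]
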